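/- All graphs are finite, simple and undirected. For a connected graph $G$ with at least one edge, let $\kappa(G)$ be Kemeny's constant of the simple random walk on $G$, that is, $\kappa(G)=\sum_{j\neq i} m_{i,j}w_j$, where $m_{i,j}$ is the mean first passage time from $i$ to $j$ and $w$ is the stationary distribution (this does not depend on $i$). For a connected graph $G$ with a specified vertex $v$ and integers $k_1,k_2\ge 0$ with $k_1+k_2\ge 2$, let $\widetilde G(v,k_1,k_2)$ be the graph obtained from $G$ and two paths with $k_1$ and $k_2$ edges by identifying $v$ with one end of each path, and let $\widehat G(v,k_1,k_2)$ be $\widetilde G(v,k_1,k_2)$ together with the edge joining the other ends of the two paths. $G$ is called $(v,k_1,k_2)$-paradoxical if $\kappa(\widehat G(v,k_1,k_2))>\kappa(\widetilde G(v,k_1,k_2))$. A sequence $G_1,G_2,\dots$ of connected graphs, each with a specified vertex $v$, is called asymptotically paradoxical if for all integers $k_1,k_2\ge 0$ with $k_1+k_2\ge 2$ there is $N>0$ such that $G_n$ is $(v,k_1,k_2)$-paradoxical for all $n\ge N$. **Proposition.** Let $(G_n)_{n\ge 1}$, where $G_n$ is a connected graph of order $n$ with a specified vertex $v$, be asymptotically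 paradoxical. (a) Let $H_1,\dots,H_\ell$ be connected graphs, with $v_i\in V(H_i)$, and let $s=\sum_{i=1}^{\ell}|V(H_i)|$. Put $G'_n=G_n$ for $1\le n\le s$, and for $n>s$ let $G'_n$ be the graph obtained from $H_1,\dots,H_\ell$ and $G_{n-s}$ by identifying the vertices $v_1,\dots,v_\ell,v$; the identified vertex is its specified vertex $v$. Then the sequence $(G'_n)_{n\ge1}$ is asymptotically paradoxical. (b) Let $H$ be a connected graph with a vertex $w$, and let $k_1,k_2\ge 0$ be integers with $k_1+k_2\ge 2$. Then there is $N>0$ such that for all $n\ge N$ the graph obtained from $H$ and $G_n$ by identifying $w$ and $v$ (as $v$) is $(v,k_1,k_2)$-paradoxical. -/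

import Mathlib

open scoped ENNReal

/-! Kemeny's constant of the simple random walk on a finite graph. -/

open Classical in
/-- Transition probability of the simple random walk: from `i`, move to a uniformly chosen
neighbour. -/
noncomputable def walkProb {V : Type} [Fintype V] (G : SimpleGraph V) (i j : V) : ℝ≥0∞ :=
  if G.Adj i j then ((G.degree i : ℕ) : ℝ≥0∞)⁻¹ else 0

open Classical in
/-- `survivalProb P t i j` is the probability that the Markov chain with transition matrix `P`,
started at `i`, visits `j` at none of the times `1, …, t`. That is, `ℙ_i (T_j > t)`, where
`T_j ≥ 1` is the first passage time to `j`. -/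
noncomputable def survivalProb {V : Type} [Fintype V] (P : V → V → ℝ≥0∞) : ℕ → V → V → ℝ≥0∞
  | 0, _, _ => 1
  | t + 1, i, j => ∑ k ∈ Finset.univ.erase j, P i k * survivalProb P t k j

/-- Mean first passage time from `i` to `j`: the expectation `𝔼_i [T_j] = ∑_{t ≥ 0} ℙ_i (T_j > t)`
of the first passage time, with values in `[0, ∞]`. -/
noncomputable def meanFirstPassage {V : Type} [Fintype V] (P : V → V → ℝ≥0∞) (i j : V) : ℝ≥0∞ :=
  ∑' t : ℕ, survivalProb P t i j

open Classical in
/-- The stationary distribution `w_j = deg j / (2 m)` of the simple random walk on a graph with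
`m` edges. See `sum_stationary` and `stationary_invariant` below. -/
noncomputable def stationary {V : Type} [Fintype V] (G : SimpleGraph V) (j : V) : ℝ≥0∞ :=
  ((G.degree j : ℕ) : ℝ≥0∞) / (2 * ((G.edgeFinset.card : ℕ) : ℝ≥0∞))

open Classical in
/-- `∑_{j ≠ i} m_{i,j} w_j`, where `m_{i,j}` are the mean first passage times and `w` is the
stationary distribution of the random walk on `G`. For connected `G` it does not depend
on `i`. -/
noncomputable def kemenyFrom {V : Type} [Fintype V] (G : SimpleGraph V) (i : V) : ℝ≥0∞ :=
  ∑ j ∈ Finset.univ.erase i, meanFirstPassage (walkProb G) i j * stationary G j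

/-- Kemeny's constant `κ(G)` of the random walk on `G`. The quantity `kemenyFrom G i` is the same
for all `i` if `G` is connected; to avoid singling out a vertex, its mean over a stationary
initial state `i` is taken. -/
noncomputable def kemeny {V : Type} [Fintype V] (G : SimpleGraph V) : ℝ≥0∞ :=
  ∑ i, stationary G i * kemenyFrom G i

/-- The weights `stationary G` sum to one if `G` has an edge. -/
theorem sum_stationary {V : Type} [Fintype V] (G : SimpleGraph V) (h : G ≠ ⊥) :
    ∑ j, stationary G j = 1 := by
  classical
  have hm : G.edgeFinset.card ≠ 0 := by
    simpa [Finset.card_eq_zero] using h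
  unfold stationary
  simp only [div_eq_mul_inv]
  rw [← Finset.sum_mul, ← Nat.cast_sum]
  have := G.sum_degrees_eq_twice_card_edges
  have h2 : (∑ x, G.degree x) = 2 * G.edgeFinset.card := this
  have h3 : ((2 * G.edgeFinset.card : ℕ) : ℝ≥0∞) ≠ 0 := by
    exact_mod_cast (mul_ne_zero two_ne_zero hm)
  convert ENNReal.mul_inv_cancel h3 (ENNReal.natCast_ne_top _) using 2
  · rw [← h2]
  · push_cast
    congr!

/-- `stationary G` is invariant under the random walk. -/
theorem stationary_invariant {V : Type} [Fintype V] (G : SimpleGraph V) (j : V) :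
    ∑ i, stationary G i * walkProb G i j = stationary G j := by
  classical
  have key : ∀ i, stationary G i * walkProb G i j =
      (if G.Adj j i then 1 else 0) * (2 * ((G.edgeFinset.card : ℕ) : ℝ≥0∞))⁻¹ := by
    intro i
    unfold stationary walkProb
    by_cases h : G.Adj j i
    · have hd : G.degree i ≠ 0 := (G.degree_pos_iff_exists_adj i |>.2 ⟨j, h.symm⟩).ne'
      have hd' : ((G.degree i : ℕ) : ℝ≥0∞) ≠ 0 := by exact_mod_cast hd
      simp only [h, h.symm, if_true, one_mul, div_eq_mul_inv]
      have e := ENNReal.mul_inv_cancel hd' (ENNReal.natCast_ne_top _)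
      calc _ = (((G.degree i : ℕ) : ℝ≥0∞) * ((G.degree i : ℕ) : ℝ≥0∞)⁻¹) *
            (2 * ((G.edgeFinset.card : ℕ) : ℝ≥0∞))⁻¹ := by
              rw [mul_right_comm]
        _ = _ := by rw [e, one_mul]
    · have h' : ¬ G.Adj i j := fun q => h q.symm
      simp [h, h']
  simp only [key]
  rw [← Finset.sum_mul]
  unfold stationary
  rw [div_eq_mul_inv]
  congr 1
  · rw [Finset.sum_boole, ← SimpleGraph.card_neighborFinset_eq_degree]
    congr 2
    ext i
    simp

/-! Graphs with a specified vertex, and the identification of vertices. -/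

/-- A finite simple graph with a specified vertex. -/
structure RootedGraph where
  /-- the vertex set -/
  V : Type
  /-- the vertex set is finite -/
  fintypeV : Fintype V
  /-- the graph -/
  graph : SimpleGraph V
  /-- the specified vertex -/
  root : V

namespace RootedGraph

instance instFintypeV (G : RootedGraph) : Fintype G.V := G.fintypeV

/-- The vertex set `{v} ∪ ⋃ i, (V(A i) - v_i)` of the graph obtained from the graphs `A i` by
identifying their specified vertices `v_i` as a new vertex `v`, here `none`. -/
abbrev GlueV {ι : Type} (A : ι → RootedGraph) : Type :=
  Option (Σ i, {x : (A i).V // x ≠ (A i).root})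

open Classical in
/-- The map from the vertices of `A i` to those of the glued graph: the specified vertex goes to
the identified vertex `v`, and every other vertex to itself. -/
noncomputable def incl {ι : Type} (A : ι → RootedGraph) (i : ι) (x : (A i).V) : GlueV A :=
  if h : x = (A i).root then none else some ⟨i, x, h⟩

theorem incl_injective {ι : Type} (A : ι → RootedGraph) (i : ι) :
    Function.Injective (incl A i) := by
  intro x y h
  unfold incl at h
  split_ifs at h with hx hy hy
  · exact hx.trans hy.symm
  · simpa using h

open Classical in
/-- The graph obtained from the graphs `A i` by identifying their specified vertices; two vertices
are adjacent if and only if they are the images of adjacent vertices of some `A i`. -/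
noncomputable def glue {ι : Type} [Fintype ι] (A : ι → RootedGraph) : RootedGraph where
  V := GlueV A
  fintypeV := inferInstance
  graph :=
    { Adj := fun x y => ∃ (i : ι) (a b : (A i).V),
        (A i).graph.Adj a b ∧ incl A i a = x ∧ incl A i b = y
      symm := ⟨by
        rintro x y ⟨i, a, b, h, ha, hb⟩
        exact ⟨i, b, a, h.symm, hb, ha⟩⟩
      loopless := ⟨by
        rintro x ⟨i, a, b, h, ha, hb⟩
        exact h.ne (incl_injective A i (ha.trans hb.symm))⟩ }
  root := none

/-- The path on `k + 1` vertices, with one of its ends specified. -/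
def path (k : ℕ) : RootedGraph where
  V := Fin (k + 1)
  fintypeV := inferInstance
  graph := SimpleGraph.pathGraph (k + 1)
  root := 0

/-- The graph obtained from `G` by attaching, at the specified vertex, two paths with `k₁` and
`k₂` edges. -/
noncomputable def tilde (G : RootedGraph) (k₁ k₂ : ℕ) : RootedGraph :=
  glue ![G, path k₁, path k₂]

/-- The other end of the first attached path. -/
noncomputable def end₁ (G : RootedGraph) (k₁ k₂ : ℕ) : (G.tilde k₁ k₂).V :=
  incl ![G, path k₁, path k₂] 1 (Fin.last k₁)

/-- The other end of the second attached path. -/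
noncomputable def end₂ (G : RootedGraph) (k₁ k₂ : ℕ) : (G.tilde k₁ k₂).V :=
  incl ![G, path k₁, path k₂] 2 (Fin.last k₂)

/-- `G.tilde k₁ k₂` with the edge between the other ends of the two attached paths inserted. -/
noncomputable def hatGraph (G : RootedGraph) (k₁ k₂ : ℕ) : SimpleGraph (G.tilde k₁ k₂).V :=
  (G.tilde k₁ k₂).graph ⊔ SimpleGraph.edge (G.end₁ k₁ k₂) (G.end₂ k₁ k₂)

/-- The connected graph `G` with specified vertex `v` is `(v, k₁, k₂)`-paradoxical
(used for `k₁ + k₂ ≥ 2` only). -/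
def IsParadoxical (G : RootedGraph) (k₁ k₂ : ℕ) : Prop :=
  G.graph.Connected ∧ kemeny (G.tilde k₁ k₂).graph < kemeny (G.hatGraph k₁ k₂)

/-- A sequence `G 1, G 2, …` of connected graphs with a specified vertex is asymptotically
paradoxical if for all `l₁, l₂ ≥ 0` with `l₁ + l₂ ≥ 2`, all but finitely many `G n` are
`(v, l₁, l₂)`-paradoxical. The term `G 0` plays no role. -/
def AsymptoticallyParadoxical (G : ℕ → RootedGraph) : Prop :=
  (∀ n, 1 ≤ n → (G n).graph.Connected) ∧
    ∀ l₁ l₂ : ℕ, 2 ≤ l₁ + l₂ → ∃ N : ℕ, 0 < N ∧ ∀ n, N ≤ n → (G n).IsParadoxical l₁ l₂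

/-- With `s = ∑ i, |V(H i)|`, the sequence whose `n`-th term is `G n` for `n ≤ s`, and for `n > s`
is obtained from `G (n - s)` and all `H i` by identifying the specified vertices. -/
noncomputable def gluedSequence {l : ℕ} (H : Fin l → RootedGraph) (G : ℕ → RootedGraph) (n : ℕ) :
    RootedGraph :=
  if n ≤ ∑ i, Fintype.card (H i).V then G n
  else glue (Fin.cons (G (n - ∑ i, Fintype.card (H i).V)) H : Fin (l + 1) → RootedGraph)

end RootedGraph

/-! Let g be the Green function of G grounded at v: g(x, y) is the voltage at x when a unit current
flows from y to v, and g(x, x) is the effective resistance between x and v. Let M be the sum of the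
degrees, D the degree-weighted sum of g(x, x), and Q the sum of d_x d_y g(x, y). Expressing hitting
times through g yields κ(G) = D - Q/M (`IsGreen.kemeny_eq`).

Current entering one part of a graph glued at v stays in that part, so D, Q and M are additive under
gluing (`green_glue`). Joining the ends of the two paths changes g by a rank-one term supported on
the paths (`IsGreen.sup_edge`). Hence D changes by -δ, where δ = `diagDrop k₁ k₂`, Q by a constant
and M by 2, whatever G is. In the comparison D cancels, and G is paradoxical iff δM² + βM + γ < 2Q
with β, γ depending only on k₁, k₂ (`isParadoxical_iff`).

For path lengths 0 and k, δ = 2k(k-1)/3 is unbounded, and M tends to infinity with the order. So an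
asymptotically paradoxical sequence has Q/M² → ∞. Conversely, this growth gives the criterion for
every k₁, k₂. Gluing on fixed graphs shifts M and Q by constants and so does not affect the growth.
-/

namespace SimpleGraph

/-! ### Dirichlet form and grounded Green function -/

section Energy

variable {V : Type} [Fintype V] (G : SimpleGraph V)

open Classical in
/-- The sum of `F x y` over the ordered pairs `(x, y)` of adjacent vertices. -/
noncomputable def dartSum (F : V → V → ℝ) : ℝ :=
  ∑ x, ∑ y, if G.Adj x y then F x y else 0

theorem dartSum_add (F F' : V → V → ℝ) :
    G.dartSum (fun x y => F x y + F' x y) = G.dartSum F + G.dartSum F' := by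
  unfold dartSum
  simp only [← Finset.sum_add_distrib]
  refine Finset.sum_congr rfl fun x _ => Finset.sum_congr rfl fun y _ => ?_
  split_ifs <;> simp

theorem dartSum_mul_left (c : ℝ) (F : V → V → ℝ) :
    G.dartSum (fun x y => c * F x y) = c * G.dartSum F := by
  unfold dartSum
  simp only [Finset.mul_sum]
  refine Finset.sum_congr rfl fun x _ => Finset.sum_congr rfl fun y _ => ?_
  split_ifs <;> simp

theorem dartSum_mul_right (c : ℝ) (F : V → V → ℝ) :
    G.dartSum (fun x y => F x y * c) = G.dartSum F * c := by
  simp only [mul_comm _ c, dartSum_mul_left]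

theorem dartSum_sub (F F' : V → V → ℝ) :
    G.dartSum (fun x y => F x y - F' x y) = G.dartSum F - G.dartSum F' := by
  have h := G.dartSum_add (fun x y => F x y - F' x y) F'
  simp only [sub_add_cancel] at h
  linarith

@[simp] theorem dartSum_zero : G.dartSum (fun _ _ => 0) = 0 := by
  simp [dartSum]

theorem dartSum_sum {α : Type*} (s : Finset α) (F : α → V → V → ℝ) :
    G.dartSum (fun x y => ∑ a ∈ s, F a x y) = ∑ a ∈ s, G.dartSum (F a) := by
  classical
  induction s using Finset.induction_on with
  | empty => simp
  | insert a s ha ih => simp only [Finset.sum_insert ha, dartSum_add, ih]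

theorem dartSum_swap (F : V → V → ℝ) : G.dartSum (fun x y => F y x) = G.dartSum F := by
  unfold dartSum
  rw [Finset.sum_comm]
  refine Finset.sum_congr rfl fun x _ => Finset.sum_congr rfl fun y _ => ?_
  rw [G.adj_comm]

theorem dartSum_nonneg {F : V → V → ℝ} (h : ∀ x y, 0 ≤ F x y) : 0 ≤ G.dartSum F :=
  Finset.sum_nonneg fun x _ => Finset.sum_nonneg fun y _ => by
    split_ifs
    · exact h x y
    · exact le_rfl

/-- The sum of `f` with respect to the degree measure. -/
noncomputable def degSum (f : V → ℝ) : ℝ := G.dartSum fun x _ => f x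

open Classical in
theorem degSum_eq (f : V → ℝ) : G.degSum f = ∑ x, (G.degree x : ℝ) * f x := by
  unfold degSum dartSum
  refine Finset.sum_congr rfl fun x _ => ?_
  rw [← Finset.sum_filter, Finset.sum_const, nsmul_eq_mul, ← card_neighborFinset_eq_degree]
  congr 3
  ext y
  simp

theorem degSum_add (f f' : V → ℝ) : G.degSum (fun x => f x + f' x) = G.degSum f + G.degSum f' :=
  G.dartSum_add _ _

theorem degSum_sub (f f' : V → ℝ) : G.degSum (fun x => f x - f' x) = G.degSum f - G.degSum f' :=
  G.dartSum_sub _ _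

theorem degSum_mul_left (c : ℝ) (f : V → ℝ) : G.degSum (fun x => c * f x) = c * G.degSum f :=
  G.dartSum_mul_left _ _

theorem degSum_mul_right (c : ℝ) (f : V → ℝ) : G.degSum (fun x => f x * c) = G.degSum f * c :=
  G.dartSum_mul_right _ _

@[simp] theorem degSum_zero : G.degSum (fun _ => 0) = 0 := G.dartSum_zero

theorem degSum_nonneg {f : V → ℝ} (h : ∀ x, 0 ≤ f x) : 0 ≤ G.degSum f :=
  G.dartSum_nonneg fun x _ => h x

/-- The Dirichlet form. -/
noncomputable def energy (φ f : V → ℝ) : ℝ :=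
  G.dartSum (fun x y => (φ x - φ y) * (f x - f y)) / 2

theorem energy_comm (φ f : V → ℝ) : G.energy φ f = G.energy f φ := by
  simp only [energy, mul_comm]

theorem energy_add_right (φ f f' : V → ℝ) :
    G.energy φ (fun x => f x + f' x) = G.energy φ f + G.energy φ f' := by
  simp only [energy, ← add_div, ← dartSum_add]
  congr 2
  ext x y
  ring

theorem energy_mul_right (c : ℝ) (φ f : V → ℝ) :
    G.energy φ (fun x => c * f x) = c * G.energy φ f := by
  simp only [energy, ← mul_div_assoc, ← dartSum_mul_left]
  congr 2
  ext x y
  ring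

theorem energy_sub_right (φ f f' : V → ℝ) :
    G.energy φ (fun x => f x - f' x) = G.energy φ f - G.energy φ f' := by
  have h := G.energy_add_right φ (fun x => f x - f' x) f'
  simp only [sub_add_cancel] at h
  linarith

theorem energy_const_right (φ : V → ℝ) (c : ℝ) : G.energy φ (fun _ => c) = 0 := by
  simp [energy]

theorem energy_const_left (f : V → ℝ) (c : ℝ) : G.energy (fun _ => c) f = 0 := by
  simp [energy]

theorem energy_sum_right {α : Type*} (s : Finset α) (φ : V → ℝ) (f : α → V → ℝ) :
    G.energy φ (fun x => ∑ a ∈ s, f a x) = ∑ a ∈ s, G.energy φ (f a) := by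
  simp only [energy, ← Finset.sum_div, ← dartSum_sum, Finset.mul_sum, ← Finset.sum_sub_distrib]

theorem energy_degSum_right (φ : V → ℝ) (f : V → V → ℝ) :
    G.energy φ (fun x => G.degSum fun y => f y x) = G.degSum fun y => G.energy φ (f y) := by
  classical
  simp only [degSum_eq, energy_sum_right, energy_mul_right]

theorem energy_self_nonneg (f : V → ℝ) : 0 ≤ G.energy f f :=
  div_nonneg (G.dartSum_nonneg fun _ _ => mul_self_nonneg _) zero_le_two

open Classical in
/-- The graph Laplacian applied to `f`. -/
noncomputable def laplace (f : V → ℝ) (x : V) : ℝ := ∑ y, if G.Adj x y then f x - f y else 0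

/-- Summation by parts: averaging the sum over darts with its reversal symmetrizes it. -/
theorem sum_mul_laplace (φ f : V → ℝ) : ∑ x, φ x * G.laplace f x = G.energy φ f := by
  have h : ∑ x, φ x * G.laplace f x = G.dartSum fun x y => φ x * (f x - f y) := by
    simp [laplace, dartSum, Finset.mul_sum]
  have h' := G.dartSum_swap fun x y => φ x * (f x - f y)
  have e : G.energy φ f = (G.dartSum (fun x y => φ x * (f x - f y)) +
      G.dartSum (fun x y => φ y * (f y - f x))) / 2 := by
    rw [← dartSum_add, energy]
    congr 2
    ext x y
    ring
  rw [h, e, h']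
  ring

open Classical in
theorem energy_single (f : V → ℝ) (x : V) :
    G.energy (fun z => if z = x then 1 else 0) f = G.laplace f x := by
  rw [← sum_mul_laplace]
  simp

variable {G}

theorem Connected.eq_of_energy_self_eq_zero (hG : G.Connected) {f : V → ℝ}
    (h : G.energy f f = 0) (x y : V) : f x = f y := by
  classical
  have h0 : G.dartSum (fun x y => (f x - f y) * (f x - f y)) = 0 := by
    unfold energy at h
    linarith
  have hadj : ∀ a b, G.Adj a b → f a = f b := by
    intro a b hab
    unfold dartSum at h0
    have nn : ∀ x y, 0 ≤ (if G.Adj x y then (f x - f y) * (f x - f y) else 0) := by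
      intro x y
      split_ifs
      · exact mul_self_nonneg _
      · exact le_rfl
    rw [Finset.sum_eq_zero_iff_of_nonneg fun x _ => Finset.sum_nonneg fun y _ => nn x y] at h0
    have h1 := h0 a (Finset.mem_univ a)
    rw [Finset.sum_eq_zero_iff_of_nonneg fun y _ => nn a y] at h1
    have h2 := h1 b (Finset.mem_univ b)
    rw [if_pos hab, mul_self_eq_zero, sub_eq_zero] at h2
    exact h2
  obtain ⟨p⟩ := hG.preconnected x y
  induction p with
  | nil => rfl
  | cons hab _ ih => exact (hadj _ _ hab).trans ih

/-- `g` is the Green function of `G` grounded at `v`: each `g · y` vanishes at `v` and is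
a potential of the unit flow from `y` to `v`. -/
structure IsGreen (G : SimpleGraph V) (v : V) (g : V → V → ℝ) : Prop where
  root_left : ∀ y, g v y = 0
  energy_right : ∀ y φ, G.energy φ (fun x => g x y) = φ y - φ v

/-- Adding 1 to the Laplacian at the diagonal entry of `v` makes it positive definite, hence
invertible. Solving with right-hand side δ_y - δ_v and testing against the constant 1 shows that the
solution vanishes at `v`, so the added term plays no role. -/
theorem Connected.exists_isGreen (hG : G.Connected) (v : V) : ∃ g, G.IsGreen v g := by
  classical
  let T : (V → ℝ) →ₗ[ℝ] (V → ℝ) :=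
    { toFun := fun f x => G.laplace f x + if x = v then f v else 0
      map_add' := fun f f' => by
        ext x
        have : G.laplace (f + f') x = G.laplace f x + G.laplace f' x := by
          simp only [laplace, ← Finset.sum_add_distrib, Pi.add_apply]
          refine Finset.sum_congr rfl fun y _ => ?_
          split_ifs <;> ring
        simp only [this, Pi.add_apply]
        split_ifs <;> ring
      map_smul' := fun c f => by
        ext x
        have : G.laplace (c • f) x = c * G.laplace f x := by
          simp only [laplace, Finset.mul_sum, Pi.smul_apply, smul_eq_mul]
          refine Finset.sum_congr rfl fun y _ => ?_
          split_ifs <;> ring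
        simp only [this, Pi.smul_apply, smul_eq_mul, RingHom.id_apply]
        split_ifs <;> ring }
  have hT : ∀ φ f, ∑ x, φ x * T f x = G.energy φ f + φ v * f v := by
    intro φ f
    change ∑ x, φ x * (G.laplace f x + if x = v then f v else 0) = _
    simp only [mul_add, Finset.sum_add_distrib, sum_mul_laplace]
    simp
  have hinj : Function.Injective T := by
    rw [injective_iff_map_eq_zero]
    intro f hf
    have h := hT f f
    simp only [hf, Pi.zero_apply, mul_zero, Finset.sum_const_zero] at h
    have h1 := G.energy_self_nonneg f
    have h2 := mul_self_nonneg (f v)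
    have hv : f v = 0 := mul_self_eq_zero.1 (by linarith)
    ext x
    rw [hG.eq_of_energy_self_eq_zero (f := f) (by linarith) x v, hv, Pi.zero_apply]
  have hsurj := LinearMap.injective_iff_surjective.1 hinj
  choose k hk using fun y => hsurj (fun x => (if x = y then 1 else 0) - if x = v then 1 else 0)
  have key : ∀ y φ, G.energy φ (k y) + φ v * k y v = φ y - φ v := by
    intro y φ
    rw [← hT, hk]
    simp [mul_sub]
  have hroot : ∀ y, k y v = 0 := by
    intro y
    have := key y fun _ => 1
    simpa [energy_const_left] using this
  refine ⟨fun x y => k y x, hroot, fun y φ => ?_⟩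
  have := key y φ
  rw [hroot] at this
  simpa using this

namespace IsGreen

variable {v : V} {g : V → V → ℝ}

theorem symm (hg : G.IsGreen v g) (x y : V) : g x y = g y x := by
  have h1 := hg.energy_right y (fun z => g z x)
  have h2 := hg.energy_right x (fun z => g z y)
  rw [energy_comm] at h1
  simp only [hg.root_left, sub_zero] at h1 h2
  rw [← h2, h1]

theorem root_right (hg : G.IsGreen v g) (x : V) : g x v = 0 := by
  rw [hg.symm, hg.root_left]

/-- The energy of `f` and the Green function with pole `x` is evaluated by the reproducing property
of each. -/
theorem eq_apply (hg : G.IsGreen v g) {y : V} {f : V → ℝ} (h0 : f v = 0)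
    (h : ∀ φ, G.energy φ f = φ y - φ v) (x : V) : g x y = f x := by
  have h1 := h (fun z => g z x)
  rw [energy_comm, hg.energy_right, h0, hg.root_left, sub_zero, sub_zero] at h1
  rw [h1, hg.symm]

theorem unique (hg : G.IsGreen v g) {g' : V → V → ℝ} (hg' : G.IsGreen v g') : g = g' := by
  ext x y
  exact hg.eq_apply (hg'.root_left y) (hg'.energy_right y) x

theorem diag_nonneg (hg : G.IsGreen v g) (x : V) : 0 ≤ g x x := by
  have h := hg.energy_right x (fun z => g z x)
  have h' := G.energy_self_nonneg (fun z => g z x)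
  rw [hg.root_left] at h
  linarith

end IsGreen

end Energy

/-! ### Hitting times and Kemeny's constant -/

section Hitting

variable {V : Type} [Fintype V] {G : SimpleGraph V}

open Classical in
theorem laplace_eq (f : V → ℝ) (x : V) :
    G.laplace f x = (G.degree x : ℝ) * f x - ∑ y, if G.Adj x y then f y else 0 := by
  have h : (G.degree x : ℝ) = ∑ y, if G.Adj x y then 1 else 0 := by
    rw [← Finset.sum_filter, Finset.sum_const, nsmul_eq_mul, mul_one,
      ← card_neighborFinset_eq_degree]
    congr 2
    ext y
    simp
  rw [h, laplace, Finset.sum_mul, ← Finset.sum_sub_distrib]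
  refine Finset.sum_congr rfl fun y _ => ?_
  split_ifs <;> ring

open Classical in
/-- `h` is the vector of expected hitting times of the vertex `j`. -/
structure IsHitting (G : SimpleGraph V) (j : V) (h : V → ℝ) : Prop where
  apply_self : h j = 0
  laplace_apply : ∀ x, x ≠ j → G.laplace h x = G.degree x

omit [Fintype V] in
theorem Connected.exists_adj_of_ne (hG : G.Connected) {x j : V} (hx : x ≠ j) : ∃ y, G.Adj x y := by
  obtain ⟨p⟩ := hG.preconnected x j
  cases p with
  | nil => exact absurd rfl hx
  | cons h _ => exact ⟨_, h⟩

open Classical in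
theorem Connected.degree_pos_of_ne (hG : G.Connected) {x j : V} (hx : x ≠ j) :
    0 < G.degree x :=
  (G.degree_pos_iff_exists_adj x).2 (hG.exists_adj_of_ne hx)

/-- Minimum principle: at a minimum other than `j` the Laplacian would be at most 0, yet it equals a
positive degree. -/
theorem IsHitting.nonneg (hG : G.Connected) {j : V} {h : V → ℝ} (hh : G.IsHitting j h) (x : V) :
    0 ≤ h x := by
  classical
  obtain ⟨z, -, hz⟩ := Finset.exists_min_image Finset.univ h ⟨x, Finset.mem_univ x⟩
  have hzj : z = j := by
    by_contra hne
    have h1 := hh.laplace_apply z hne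
    have h2 : G.laplace h z ≤ 0 := Finset.sum_nonpos fun y _ => by
      split_ifs
      · have := hz y (Finset.mem_univ y)
        linarith
      · exact le_rfl
    have h3 : (0 : ℝ) < G.degree z := by exact_mod_cast hG.degree_pos_of_ne hne
    linarith
  have := hz x (Finset.mem_univ x)
  rwa [hzj, hh.apply_self] at this

/-- The difference of two solutions vanishes at `j` and is harmonic elsewhere, so its energy is
zero. -/
theorem IsHitting.unique (hG : G.Connected) {j : V} {h h' : V → ℝ} (hh : G.IsHitting j h)
    (hh' : G.IsHitting j h') (x : V) : h x = h' x := by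
  classical
  have hlap : ∀ z, G.laplace (fun z => h z - h' z) z = G.laplace h z - G.laplace h' z := by
    intro z
    rw [← energy_single, ← energy_single, ← energy_single, energy_sub_right]
  have hE : G.energy (fun z => h z - h' z) (fun z => h z - h' z) = 0 := by
    rw [← sum_mul_laplace]
    refine Finset.sum_eq_zero fun z _ => ?_
    by_cases hz : z = j
    · rw [hz, hh.apply_self, hh'.apply_self]
      simp
    · rw [hlap, hh.laplace_apply z hz, hh'.laplace_apply z hz]
      simp
  have := hG.eq_of_energy_self_eq_zero hE x j
  simp only [hh.apply_self, hh'.apply_self] at this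
  linarith

theorem IsHitting.one_add_sum (hG : G.Connected) {j : V} {h : V → ℝ}
    (hh : G.IsHitting j h) {x : V} (hx : x ≠ j) :
    h x = 1 + ∑ k, (walkProb G x k).toReal * h k := by
  classical
  have h1 := hh.laplace_apply x hx
  have h3 : (0 : ℝ) < G.degree x := by exact_mod_cast hG.degree_pos_of_ne hx
  have h2 : ∑ k, (walkProb G x k).toReal * h k =
      (G.degree x : ℝ)⁻¹ * ∑ k, if G.Adj x k then h k else 0 := by
    rw [Finset.mul_sum]
    refine Finset.sum_congr rfl fun k _ => ?_
    unfold walkProb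
    split_ifs <;> simp
  rw [laplace_eq] at h1
  rw [h2]
  field_simp
  linarith

theorem isHitting_of_one_add_sum (hG : G.Connected) {j : V} {h : V → ℝ} (h0 : h j = 0)
    (hh : ∀ x, x ≠ j → h x = 1 + ∑ k, (walkProb G x k).toReal * h k) : G.IsHitting j h := by
  classical
  refine ⟨h0, fun x hx => ?_⟩
  have h1 := hh x hx
  have h3 : (0 : ℝ) < G.degree x := by exact_mod_cast hG.degree_pos_of_ne hx
  have h2 : ∑ k, (walkProb G x k).toReal * h k =
      (G.degree x : ℝ)⁻¹ * ∑ k, if G.Adj x k then h k else 0 := by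
    rw [Finset.mul_sum]
    refine Finset.sum_congr rfl fun k _ => ?_
    unfold walkProb
    split_ifs <;> simp
  rw [laplace_eq]
  rw [h2] at h1
  field_simp at h1
  linarith

theorem walkProb_ne_top (x k : V) : walkProb G x k ≠ ∞ := by
  classical
  unfold walkProb
  split_ifs with h
  · have : G.degree x ≠ 0 := ((G.degree_pos_iff_exists_adj x).2 ⟨k, h⟩).ne'
    simpa using this
  · simp

-- First-step analysis: the term t = 0 is split off the series.
open Classical in
theorem meanFirstPassage_eq_one_add (P : V → V → ℝ≥0∞) (i j : V) :
    meanFirstPassage P i j =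
      1 + ∑ k ∈ Finset.univ.erase j, P i k * meanFirstPassage P k j := by
  unfold meanFirstPassage
  rw [tsum_eq_zero_add' ENNReal.summable]
  simp only [survivalProb]
  rw [Summable.tsum_finsetSum fun _ _ => ENNReal.summable]
  simp only [ENNReal.tsum_mul_left]

/-- Each partial sum of the series is bounded by `h`, by induction on its length. This supplies the
finiteness needed to pass to real numbers. -/
theorem IsHitting.meanFirstPassage_le (hG : G.Connected) {j : V} {h : V → ℝ}
    (hh : G.IsHitting j h) {i : V} (hi : i ≠ j) :
    meanFirstPassage (walkProb G) i j ≤ ENNReal.ofReal (h i) := by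
  classical
  refine ENNReal.tsum_le_of_sum_range_le fun n => ?_
  induction n generalizing i with
  | zero => simp
  | succ n ih =>
    rw [Finset.sum_range_succ']
    simp only [survivalProb]
    rw [Finset.sum_comm]
    simp only [← Finset.mul_sum]
    have hn : ∀ k ∈ Finset.univ, 0 ≤ (walkProb G i k).toReal * h k := fun k _ =>
      mul_nonneg ENNReal.toReal_nonneg (hh.nonneg hG k)
    rw [hh.one_add_sum hG hi, ENNReal.ofReal_add zero_le_one (Finset.sum_nonneg hn),
      ENNReal.ofReal_one, add_comm, ENNReal.ofReal_sum_of_nonneg hn]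
    gcongr
    calc ∑ k ∈ Finset.univ.erase j, walkProb G i k *
          ∑ t ∈ Finset.range n, survivalProb (walkProb G) t k j
        ≤ ∑ k ∈ Finset.univ.erase j, ENNReal.ofReal ((walkProb G i k).toReal * h k) := by
          refine Finset.sum_le_sum fun k hk => ?_
          rw [ENNReal.ofReal_mul ENNReal.toReal_nonneg, ENNReal.ofReal_toReal (walkProb_ne_top _ _)]
          gcongr
          exact ih (Finset.ne_of_mem_erase hk)
      _ ≤ _ := Finset.sum_le_sum_of_subset (Finset.subset_univ _)

theorem IsHitting.meanFirstPassage_eq (hG : G.Connected) {j : V} {h : V → ℝ}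
    (hh : G.IsHitting j h) {i : V} (hi : i ≠ j) :
    meanFirstPassage (walkProb G) i j = ENNReal.ofReal (h i) := by
  classical
  have hfin : ∀ k, k ≠ j → meanFirstPassage (walkProb G) k j ≠ ∞ := fun k hk =>
    ne_top_of_le_ne_top ENNReal.ofReal_ne_top (hh.meanFirstPassage_le hG hk)
  -- `meanFirstPassage` at (j, j) is the mean return time, so the value at `j` has to be replaced by
  -- 0.
  have hM : G.IsHitting j
      (fun x => if x = j then 0 else (meanFirstPassage (walkProb G) x j).toReal) := by
    refine isHitting_of_one_add_sum hG (if_pos rfl) fun x hx => ?_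
    rw [if_neg hx, meanFirstPassage_eq_one_add, ENNReal.toReal_add ENNReal.one_ne_top,
      ENNReal.toReal_sum, ENNReal.toReal_one,
      ← Finset.sum_erase (a := j) Finset.univ (f := fun k => (walkProb G x k).toReal *
        if k = j then 0 else (meanFirstPassage (walkProb G) k j).toReal)]
    · congr 1
      refine Finset.sum_congr rfl fun k hk => ?_
      rw [if_neg (Finset.ne_of_mem_erase hk), ENNReal.toReal_mul]
    · simp
    · exact fun k hk => ENNReal.mul_ne_top (walkProb_ne_top _ _) (hfin k (Finset.ne_of_mem_erase hk))
    · exact ENNReal.sum_ne_top.2 fun k hk =>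
        ENNReal.mul_ne_top (walkProb_ne_top _ _) (hfin k (Finset.ne_of_mem_erase hk))
  have := hM.unique hG hh i
  rw [if_neg hi] at this
  rw [← this, ENNReal.ofReal_toReal (hfin i hi)]

/-- As a function of x, the summand has Laplacian δ_y - δ_j, the contributions at `v` cancelling.
Away from `j` the degree-weighted sum over y is therefore the degree. -/
theorem IsGreen.isHitting {v : V} {g : V → V → ℝ} (hg : G.IsGreen v g) (j : V) :
    G.IsHitting j (fun x => G.degSum fun y => g j j - g j y - g x j + g x y) := by
  classical
  refine ⟨?_, fun x hx => ?_⟩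
  · simp
  · rw [← energy_single, energy_degSum_right]
    simp only [energy_add_right, energy_sub_right, energy_const_right, hg.energy_right, degSum_eq]
    simp [Ne.symm hx]

theorem degSum_one : G.degSum (fun _ => 1) = 2 * (Nat.card G.edgeSet : ℝ) := by
  classical
  have h := G.sum_degrees_eq_twice_card_edges
  rw [degSum_eq]
  simp only [mul_one]
  rw [Nat.card_eq_fintype_card, ← edgeFinset_card]
  exact_mod_cast h

open Classical in
theorem stationary_eq (hpos : 0 < G.degSum fun _ => 1) (j : V) :
    stationary G j = ENNReal.ofReal ((G.degree j : ℝ) / G.degSum fun _ => 1) := by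
  rw [ENNReal.ofReal_div_of_pos hpos, degSum_one]
  unfold stationary
  congr 1
  · simp
  · rw [Nat.card_eq_fintype_card, ← edgeFinset_card, ENNReal.ofReal_mul zero_le_two]
    simp

/-- Kemeny's constant in terms of a grounded Green function. -/
theorem IsGreen.kemeny_eq (hG : G.Connected) {v : V} {g : V → V → ℝ} (hg : G.IsGreen v g)
    (hpos : 0 < G.degSum fun _ => 1) :
    0 ≤ (G.degSum fun x => g x x) -
      (G.degSum fun y => G.degSum fun x => g x y) / (G.degSum fun _ => 1) ∧
    kemeny G = ENNReal.ofReal ((G.degSum fun x => g x x) -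
      (G.degSum fun y => G.degSum fun x => g x y) / G.degSum fun _ => 1) := by
  classical
  set M := G.degSum fun _ => 1 with hM
  set h : V → V → ℝ := fun j x => G.degSum fun y => g j j - g j y - g x j + g x y with hh
  have hnn : ∀ i j, 0 ≤ h j i := fun i j => (hg.isHitting j).nonneg hG i
  have h1 : kemeny G = ENNReal.ofReal (∑ i, ((G.degree i : ℝ) / M) *
      ∑ j, h j i * ((G.degree j : ℝ) / M)) := by
    unfold kemeny kemenyFrom
    have hdn : ∀ i, 0 ≤ (G.degree i : ℝ) / M := fun i => by positivity
    have hin : ∀ i, 0 ≤ ∑ j, h j i * ((G.degree j : ℝ) / M) := fun i =>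
      Finset.sum_nonneg fun j _ => mul_nonneg (hnn i j) (hdn j)
    rw [ENNReal.ofReal_sum_of_nonneg fun i _ => mul_nonneg (hdn i) (hin i)]
    refine Finset.sum_congr rfl fun i _ => ?_
    rw [ENNReal.ofReal_mul (hdn i), stationary_eq hpos,
      ENNReal.ofReal_sum_of_nonneg fun j _ => mul_nonneg (hnn i j) (hdn j)]
    congr 1
    -- The omitted term j = i is zero, since the hitting time of i from i vanishes.
    rw [← Finset.sum_erase (a := i) (s := Finset.univ) (f := fun j => ENNReal.ofReal _)]
    · refine Finset.sum_congr rfl fun j hj => ?_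
      rw [ENNReal.ofReal_mul (hnn i j), stationary_eq hpos,
        (hg.isHitting j).meanFirstPassage_eq hG (Finset.ne_of_mem_erase hj).symm]
    · rw [show h i i = 0 from (hg.isHitting i).apply_self]
      simp
  have h2 : ∑ i, ((G.degree i : ℝ) / M) * ∑ j, h j i * ((G.degree j : ℝ) / M) =
      (G.degSum fun i => G.degSum fun j => h j i) / M ^ 2 := by
    simp only [degSum_eq, Finset.sum_div, Finset.mul_sum]
    refine Finset.sum_congr rfl fun i _ => Finset.sum_congr rfl fun j _ => ?_
    field_simp
  have hc : ∀ c : ℝ, G.degSum (fun _ => c) = c * M := by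
    intro c
    rw [hM, ← degSum_mul_left]
    simp
  have h3 : (G.degSum fun i => G.degSum fun j => h j i) / M ^ 2 =
      (G.degSum fun x => g x x) - (G.degSum fun y => G.degSum fun x => g x y) / M := by
    -- Of the four terms of the hitting time, the first gives M² times the diagonal sum. The other
    -- three give -1, -1 and +1 times M times the quadratic sum.
    have e : (G.degSum fun i => G.degSum fun j => h j i) = M * (M * G.degSum fun x => g x x) -
        M * G.degSum fun y => G.degSum fun x => g x y := by
      have s1 : ∀ a : V → ℝ, (G.degSum fun y => a y * M) = M * G.degSum a := by
        intro a
        rw [degSum_mul_right, mul_comm]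
      have s2 : (G.degSum fun j => G.degSum (g j)) =
          G.degSum fun y => G.degSum fun x => g x y :=
        congrArg G.degSum (funext fun j => congrArg G.degSum (funext fun y => hg.symm j y))
      simp only [hh, degSum_add, degSum_sub, hc, s1]
      rw [degSum_mul_left, s2]
      ring
    rw [e]
    field_simp
  rw [h2, h3] at h1
  refine ⟨?_, h1⟩
  rw [← h3]
  exact div_nonneg (degSum_nonneg _ fun i => degSum_nonneg _ fun j => hnn i j) (sq_nonneg _)

end Hitting

end SimpleGraph

/-! ### Insertion of an edge -/

namespace SimpleGraph

variable {V : Type} [Fintype V] {G : SimpleGraph V} {a b : V}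

theorem dartSum_sup_edge (hab : a ≠ b) (hadj : ¬ G.Adj a b) (F : V → V → ℝ) :
    (G ⊔ edge a b).dartSum F = G.dartSum F + (F a b + F b a) := by
  classical
  have key : ∀ (x y : V) {inst : Decidable ((G ⊔ edge a b).Adj x y)},
      @ite _ ((G ⊔ edge a b).Adj x y) inst (F x y) 0 =
      (if G.Adj x y then F x y else 0) +
        ((if x = a then if y = b then F x y else 0 else 0) +
          if x = b then if y = a then F x y else 0 else 0) := by
    intro x y _
    have hadj' : ¬ G.Adj b a := fun h => hadj h.symm
    simp only [sup_adj, edge_adj]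
    by_cases h1 : x = a ∧ y = b
    · obtain ⟨rfl, rfl⟩ := h1
      simp [hadj, hab]
    · by_cases h2 : x = b ∧ y = a
      · obtain ⟨rfl, rfl⟩ := h2
        simp [hadj', hab.symm]
      · have e1 : (if x = a then if y = b then F x y else 0 else 0) = 0 := by
          split_ifs <;> simp_all
        have e2 : (if x = b then if y = a then F x y else 0 else 0) = 0 := by
          split_ifs <;> simp_all
        rw [e1, e2]
        simp [h1, h2]
  unfold dartSum
  simp only [key, Finset.sum_add_distrib, Finset.sum_ite_irrel, Finset.sum_const_zero,
    Finset.sum_ite_eq', Finset.mem_univ, if_true]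

theorem degSum_sup_edge (hab : a ≠ b) (hadj : ¬ G.Adj a b) (f : V → ℝ) :
    (G ⊔ edge a b).degSum f = G.degSum f + (f a + f b) :=
  dartSum_sup_edge hab hadj _

theorem energy_sup_edge (hab : a ≠ b) (hadj : ¬ G.Adj a b) (φ f : V → ℝ) :
    (G ⊔ edge a b).energy φ f = G.energy φ f + (φ a - φ b) * (f a - f b) := by
  unfold energy
  rw [dartSum_sup_edge hab hadj]
  ring

namespace IsGreen

variable {v : V} {g : V → V → ℝ}

/-- The Sherman–Morrison formula for the insertion of an edge. -/
theorem sup_edge (hg : G.IsGreen v g) (hab : a ≠ b) (hadj : ¬ G.Adj a b) (h0 : g a b = 0) :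
    (G ⊔ edge a b).IsGreen v fun x y =>
      g x y - (1 + (g a a + g b b))⁻¹ * (g y a - g y b) * (g x a - g x b) := by
  refine ⟨fun y => ?_, fun y φ => ?_⟩
  · simp [hg.root_left]
  · have hc : 1 + (g a a + g b b) ≠ 0 := by
      have h1 := hg.diag_nonneg a
      have h2 := hg.diag_nonneg b
      linarith
    simp only [energy_sup_edge hab hadj, energy_sub_right, energy_mul_right, hg.energy_right]
    rw [hg.symm a y, hg.symm b y, hg.symm b a, h0]
    field_simp
    ring

/-- Besides the change of the Green function, the degrees of `a` and `b` grow by one, so the values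
there are counted once more. The same holds for `quadSum_sup_edge`. -/
theorem diagSum_sup_edge (hg : G.IsGreen v g) (hab : a ≠ b) (hadj : ¬ G.Adj a b)
    (h0 : g a b = 0) :
    ((G ⊔ edge a b).degSum fun x =>
        g x x - (1 + (g a a + g b b))⁻¹ * (g x a - g x b) * (g x a - g x b)) =
      (G.degSum fun x => g x x) + (g a a + g b b) -
      (1 + (g a a + g b b))⁻¹ *
        ((G.degSum fun x => (g x a - g x b) ^ 2) + g a a ^ 2 + g b b ^ 2) := by
  have h0' : g b a = 0 := by rw [hg.symm, h0]
  rw [degSum_sup_edge hab hadj, degSum_sub]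
  simp only [mul_assoc, degSum_mul_left, ← pow_two, h0, h0']
  ring

theorem quadSum_sup_edge (hg : G.IsGreen v g) (hab : a ≠ b) (hadj : ¬ G.Adj a b)
    (h0 : g a b = 0) :
    ((G ⊔ edge a b).degSum fun y => (G ⊔ edge a b).degSum fun x =>
        g x y - (1 + (g a a + g b b))⁻¹ * (g y a - g y b) * (g x a - g x b)) =
      (G.degSum fun y => G.degSum fun x => g x y) +
      2 * ((G.degSum fun x => g x a) + G.degSum fun x => g x b) + (g a a + g b b) -
      (1 + (g a a + g b b))⁻¹ *
        ((G.degSum fun x => g x a) - (G.degSum fun x => g x b) + g a a - g b b) ^ 2 := by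
  have h0' : g b a = 0 := by rw [hg.symm, h0]
  have hs : ∀ c, (G.degSum fun y => g c y) = G.degSum fun x => g x c := fun c => by
    simp only [hg.symm c]
  simp only [degSum_sup_edge hab hadj, degSum_add, degSum_sub, degSum_mul_left, degSum_mul_right,
    hs, h0, h0', mul_assoc]
  ring

end IsGreen

end SimpleGraph

/-! ### Additivity under gluing at a vertex -/

namespace RootedGraph

/-- The Green function of a connected graph, grounded at the specified vertex. -/
noncomputable def green (G : RootedGraph) : G.V → G.V → ℝ :=
  Classical.epsilon (G.graph.IsGreen G.root)

theorem isGreen_green {G : RootedGraph} (hG : G.graph.Connected) :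
    G.graph.IsGreen G.root G.green :=
  Classical.epsilon_spec (hG.exists_isGreen G.root)

/-- The sum of the degrees. -/
noncomputable def vol (G : RootedGraph) : ℝ := G.graph.degSum fun _ => 1

/-- The degree-weighted sum of the effective resistances to the specified vertex. -/
noncomputable def diagSum (G : RootedGraph) : ℝ := G.graph.degSum fun x => G.green x x

/-- The Green function as a quadratic form, applied to the vector of degrees. -/
noncomputable def quadSum (G : RootedGraph) : ℝ :=
  G.graph.degSum fun y => G.graph.degSum fun x => G.green x y

/-- The degree-weighted sum of the Green function with pole `a`. -/
noncomputable def greenSum (G : RootedGraph) (a : G.V) : ℝ :=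
  G.graph.degSum fun x => G.green x a

/-- The degree-weighted sum of squares of the Green function with pole `a`. -/
noncomputable def greenSqSum (G : RootedGraph) (a : G.V) : ℝ :=
  G.graph.degSum fun x => G.green x a ^ 2

theorem kemeny_eq {G : RootedGraph} (hG : G.graph.Connected) (hpos : 0 < G.vol) :
    0 ≤ G.diagSum - G.quadSum / G.vol ∧
      kemeny G.graph = ENNReal.ofReal (G.diagSum - G.quadSum / G.vol) :=
  (isGreen_green hG).kemeny_eq hG hpos

theorem green_root_left {G : RootedGraph} (hG : G.graph.Connected) (y : G.V) :
    G.green G.root y = 0 := (isGreen_green hG).root_left y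

theorem green_root_right {G : RootedGraph} (hG : G.graph.Connected) (x : G.V) :
    G.green x G.root = 0 := (isGreen_green hG).root_right x

section Glue

variable {ι : Type} (A : ι → RootedGraph)

@[simp] theorem incl_root (i : ι) : incl A i (A i).root = none := by
  simp [incl]

theorem incl_eq_incl {i j : ι} {a : (A i).V} {b : (A j).V} (h : incl A i a = incl A j b)
    (ha : a ≠ (A i).root) : i = j := by
  unfold incl at h
  rw [dif_neg ha] at h
  split_ifs at h
  simp only [Option.some.injEq, Sigma.mk.injEq] at h
  exact h.1

open Classical in
/-- The retraction of the glued graph onto the graph `A i`, which sends the other graphs to the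
specified vertex. -/
noncomputable def retract (i : ι) (z : GlueV A) : (A i).V :=
  if h : ∃ x, incl A i x = z then h.choose else (A i).root

@[simp] theorem retract_incl (i : ι) (x : (A i).V) : retract A i (incl A i x) = x := by
  have h : ∃ x', incl A i x' = incl A i x := ⟨x, rfl⟩
  unfold retract
  rw [dif_pos h]
  exact incl_injective A i h.choose_spec

theorem retract_incl_of_ne {i j : ι} (h : i ≠ j) (x : (A j).V) :
    retract A i (incl A j x) = (A i).root := by
  unfold retract
  split_ifs with hx
  · by_contra hne
    exact h (incl_eq_incl A hx.choose_spec hne)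
  · rfl

@[simp] theorem retract_none (i : ι) : retract A i none = (A i).root := by
  rw [← incl_root A i, retract_incl]

variable [Fintype ι]

theorem glue_adj_incl {i : ι} {a b : (A i).V} (h : (A i).graph.Adj a b) :
    (glue A).graph.Adj (incl A i a) (incl A i b) :=
  ⟨i, a, b, h, rfl, rfl⟩

variable {A} in
theorem glue_connected (hA : ∀ i, (A i).graph.Connected) : (glue A).graph.Connected := by
  have key : ∀ z : (glue A).V, (glue A).graph.Reachable z (none : GlueV A) := by
    intro z
    match z with
    | none => exact SimpleGraph.Reachable.refl _
    | some ⟨i, x, hx⟩ =>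
      let f : (A i).graph →g (glue A).graph := ⟨incl A i, fun h => glue_adj_incl A h⟩
      have h := ((hA i).preconnected x (A i).root).map f
      have e1 : f x = (some ⟨i, x, hx⟩ : GlueV A) := dif_neg hx
      have e2 : f (A i).root = (none : GlueV A) := incl_root A i
      rwa [e1, e2] at h
  have : Nonempty (glue A).V := ⟨(none : GlueV A)⟩
  exact ⟨fun x y => (key x).trans (key y).symm⟩

/-- Adjacent vertices are not both the identified vertex, so each dart comes from exactly one part.
-/
theorem dartSum_glue (F : (glue A).V → (glue A).V → ℝ) :
    (glue A).graph.dartSum F =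
      ∑ i, (A i).graph.dartSum fun a b => F (incl A i a) (incl A i b) := by
  classical
  unfold SimpleGraph.dartSum
  have hprod : ∀ (W : Type) [Fintype W] (f : W → W → ℝ), ∑ x, ∑ y, f x y = ∑ p : W × W, f p.1 p.2 :=
    fun W _ f => (Fintype.sum_prod_type' f).symm
  simp only [hprod]
  simp only [← Finset.sum_filter]
  rw [Finset.sum_sigma']
  symm
  refine Finset.sum_bij (fun p _ => (incl A p.1 p.2.1, incl A p.1 p.2.2)) ?_ ?_ ?_ ?_
  · rintro ⟨i, a, b⟩ h
    simp only [Finset.mem_sigma, Finset.mem_filter, Finset.mem_univ, true_and] at h ⊢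
    exact glue_adj_incl A h
  · rintro ⟨i, a, b⟩ h ⟨j, a', b'⟩ h' e
    simp only [Finset.mem_sigma, Finset.mem_filter, Finset.mem_univ, true_and] at h
    have e1 : incl A i a = incl A j a' := congrArg Prod.fst e
    have e2 : incl A i b = incl A j b' := congrArg Prod.snd e
    have hij : i = j := by
      by_cases ha : a = (A i).root
      · exact incl_eq_incl A e2 fun hb => h.ne (ha.trans hb.symm)
      · exact incl_eq_incl A e1 ha
    subst hij
    rw [incl_injective A i e1, incl_injective A i e2]
  · rintro ⟨x, y⟩ h
    simp only [Finset.mem_filter, Finset.mem_univ, true_and] at h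
    obtain ⟨i, a, b, hab, rfl, rfl⟩ := h
    exact ⟨⟨i, a, b⟩, by simpa using hab, rfl⟩
  · intro p _
    rfl

theorem degSum_glue (f : (glue A).V → ℝ) :
    (glue A).graph.degSum f = ∑ i, (A i).graph.degSum fun a => f (incl A i a) :=
  dartSum_glue A _

theorem energy_glue (φ f : (glue A).V → ℝ) :
    (glue A).graph.energy φ f =
      ∑ i, (A i).graph.energy (fun a => φ (incl A i a)) fun a => f (incl A i a) := by
  unfold SimpleGraph.energy
  rw [dartSum_glue, Finset.sum_div]

theorem vol_glue : (glue A).vol = ∑ i, (A i).vol := degSum_glue A _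

variable {A}

/-- The i-th summand is constant on every other part, so its energy lives on `A i` alone. The
resulting differences vanish except for the part containing the pole. -/
theorem green_glue (hA : ∀ i, (A i).graph.Connected) :
    (glue A).green = fun x y : GlueV A => ∑ i, (A i).green (retract A i x) (retract A i y) := by
  refine (isGreen_green (glue_connected hA)).unique ⟨fun y => ?_, fun y φ => ?_⟩
  · refine Finset.sum_eq_zero fun i _ => ?_
    have : retract A i (glue A).root = (A i).root := retract_none A i
    rw [this, green_root_left (hA i)]
  · rw [SimpleGraph.energy_sum_right]
    have key : ∀ i, (glue A).graph.energy φ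
        (fun x => (A i).green (retract A i x) (retract A i y)) =
        φ (incl A i (retract A i y)) - φ (none : GlueV A) := by
      intro i
      rw [energy_glue, Finset.sum_eq_single i]
      · simp only [retract_incl]
        rw [(isGreen_green (hA i)).energy_right, incl_root]
      · intro j _ hj
        simp only [retract_incl_of_ne A hj.symm, green_root_left (hA i)]
        exact SimpleGraph.energy_const_right _ _ _
      · simp
    simp only [key]
    change _ = φ y - φ (none : GlueV A)
    match y with
    | none => simp
    | some ⟨i, x, hx⟩ =>
      have e : incl A i x = some ⟨i, x, hx⟩ := dif_neg hx
      rw [← e, Finset.sum_eq_single i]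
      · rw [retract_incl]
      · intro j _ hj
        rw [retract_incl_of_ne A hj, incl_root, sub_self]
      · simp

theorem green_glue_incl (hA : ∀ i, (A i).graph.Connected) (i : ι) (x y : (A i).V) :
    (glue A).green (incl A i x) (incl A i y) = (A i).green x y := by
  rw [green_glue hA]
  simp only
  rw [Finset.sum_eq_single i]
  · simp
  · intro j _ hj
    rw [retract_incl_of_ne A hj, green_root_left (hA j)]
  · simp

theorem green_glue_incl_of_ne (hA : ∀ i, (A i).graph.Connected) {i j : ι} (hij : i ≠ j)
    (x : (A i).V) (y : (A j).V) : (glue A).green (incl A i x) (incl A j y) = 0 := by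
  rw [green_glue hA]
  refine Finset.sum_eq_zero fun k _ => ?_
  by_cases hk : k = i
  · subst hk
    rw [retract_incl_of_ne A hij, green_root_right (hA k)]
  · rw [retract_incl_of_ne A hk, green_root_left (hA k)]

theorem greenSum_glue (hA : ∀ i, (A i).graph.Connected) (i : ι) (a : (A i).V) :
    (glue A).greenSum (incl A i a) = (A i).greenSum a := by
  unfold greenSum
  rw [degSum_glue, Finset.sum_eq_single i]
  · simp only [green_glue_incl hA]
  · intro j _ hj
    simp only [green_glue_incl_of_ne hA hj]
    exact SimpleGraph.degSum_zero _
  · simp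

theorem diagSum_glue (hA : ∀ i, (A i).graph.Connected) :
    (glue A).diagSum = ∑ i, (A i).diagSum := by
  unfold diagSum
  rw [degSum_glue]
  simp only [green_glue_incl hA]

theorem quadSum_glue (hA : ∀ i, (A i).graph.Connected) :
    (glue A).quadSum = ∑ i, (A i).quadSum := by
  change (glue A).graph.degSum (fun y => (glue A).greenSum y) = _
  rw [degSum_glue]
  simp only [greenSum_glue hA]
  rfl

end Glue

end RootedGraph

/-! ### Paths -/

namespace SimpleGraph

theorem dartSum_pathGraph (k : ℕ) (F : Fin (k + 1) → Fin (k + 1) → ℝ) :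
    (pathGraph (k + 1)).dartSum F =
      ∑ i : Fin k, (F i.castSucc i.succ + F i.succ i.castSucc) := by
  classical
  have key : ∀ F : Fin (k + 1) → Fin (k + 1) → ℝ,
      (∑ x : Fin (k + 1), ∑ y : Fin (k + 1), if (x : ℕ) + 1 = y then F x y else 0) =
        ∑ i : Fin k, F i.castSucc i.succ := by
    intro F
    rw [Finset.sum_comm, Fin.sum_univ_succ]
    have h0 : ∑ x : Fin (k + 1), (if (x : ℕ) + 1 = (0 : Fin (k + 1)) then F x 0 else 0) = 0 :=
      Finset.sum_eq_zero fun x _ => by simp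
    rw [h0, zero_add]
    refine Finset.sum_congr rfl fun i _ => ?_
    rw [Finset.sum_eq_single i.castSucc]
    · simp
    · intro x _ hx
      rw [if_neg]
      intro h
      apply hx
      ext
      simpa using h
    · simp
  have split : ∀ (x y : Fin (k + 1)) {inst : Decidable ((pathGraph (k + 1)).Adj x y)},
      @ite _ ((pathGraph (k + 1)).Adj x y) inst (F x y) 0 =
        (if (x : ℕ) + 1 = y then F x y else 0) + if (y : ℕ) + 1 = x then F x y else 0 := by
    intro x y _
    simp only [pathGraph_adj]
    by_cases h1 : (x : ℕ) + 1 = y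
    · have h2 : ¬ (y : ℕ) + 1 = x := by omega
      simp [h1, h2]
    · simp [h1]
  unfold dartSum
  simp only [split, Finset.sum_add_distrib]
  congr 1
  · exact key F
  · rw [Finset.sum_comm]
    exact key fun x y => F y x

theorem degSum_pathGraph (k : ℕ) (f : Fin (k + 1) → ℝ) :
    (pathGraph (k + 1)).degSum f = ∑ i : Fin k, (f i.castSucc + f i.succ) :=
  dartSum_pathGraph k _

/-- The distance to 0 has slope one along the path, so the energy telescopes. It is thus the Green
function with pole at the far end. -/
theorem energy_pathGraph_val (k : ℕ) (φ : Fin (k + 1) → ℝ) :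
    (pathGraph (k + 1)).energy φ (fun x => (x : ℕ)) = φ (Fin.last k) - φ 0 := by
  have h : ∀ k (φ : Fin (k + 1) → ℝ), ∑ i : Fin k, (φ i.succ - φ i.castSucc) =
      φ (Fin.last k) - φ 0 := by
    intro k
    induction k with
    | zero => intro φ; simp
    | succ k ih =>
      intro φ
      rw [Fin.sum_univ_castSucc]
      have := ih fun i => φ i.castSucc
      simp only [← Fin.succ_castSucc] at this ⊢
      rw [this]
      simp
  rw [energy, dartSum_pathGraph, ← h, Finset.sum_div]
  refine Finset.sum_congr rfl fun i _ => ?_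
  simp only [Fin.val_castSucc, Fin.val_succ]
  push_cast
  ring

end SimpleGraph

namespace RootedGraph

theorem path_connected (k : ℕ) : (path k).graph.Connected := SimpleGraph.pathGraph_connected k

theorem vol_path (k : ℕ) : (path k).vol = 2 * k := by
  refine (SimpleGraph.degSum_pathGraph k fun _ => 1).trans ?_
  simp
  ring

theorem green_path_last (k : ℕ) (x : Fin (k + 1)) :
    (path k).green x (Fin.last k) = (x : ℕ) :=
  (isGreen_green (path_connected k)).eq_apply (f := fun x : Fin (k + 1) => ((x : ℕ) : ℝ))
    (by simp [path]) (SimpleGraph.energy_pathGraph_val k) x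

theorem greenSqSum_path_last (k : ℕ) :
    (path k).greenSqSum (Fin.last k) = k * (2 * k ^ 2 + 1) / 3 := by
  refine (SimpleGraph.degSum_pathGraph k _).trans ?_
  refine (Finset.sum_congr rfl fun i _ => by rw [green_path_last, green_path_last]).trans ?_
  simp only [Fin.val_castSucc, Fin.val_succ]
  rw [Fin.sum_univ_eq_sum_range fun i => ((i : ℕ) : ℝ) ^ 2 + ((i + 1 : ℕ) : ℝ) ^ 2]
  induction k with
  | zero => simp
  | succ k ih =>
    rw [Finset.sum_range_succ, ih]
    push_cast
    ring

/-! ### An edge between two parts of a glued graph -/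

section JoinedEnds

variable {ι : Type} [Fintype ι] {A : ι → RootedGraph} {i j : ι} {a : (A i).V} {b : (A j).V}

omit [Fintype ι] in
theorem incl_ne_incl (hij : i ≠ j) (h : a = (A i).root → b ≠ (A j).root) :
    incl A i a ≠ incl A j b := by
  intro e
  by_cases ha : a = (A i).root
  · exact hij (incl_eq_incl A e.symm (h ha)).symm
  · exact hij (incl_eq_incl A e ha)

theorem not_glue_adj_incl (hij : i ≠ j) (h : a = (A i).root → b ≠ (A j).root)
    (ha : a = (A i).root → ¬ (A j).graph.Adj (A j).root b)
    (hb : b = (A j).root → ¬ (A i).graph.Adj a (A i).root) :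
    ¬ (glue A).graph.Adj (incl A i a) (incl A j b) := by
  rintro ⟨k, c, d, hcd, hc, hd⟩
  by_cases ha' : a = (A i).root
  · obtain rfl := incl_eq_incl A hd.symm (h ha')
    rw [ha', incl_root, ← incl_root A j] at hc
    rw [incl_injective A j hc, incl_injective A j hd] at hcd
    exact ha ha' hcd
  · obtain rfl := incl_eq_incl A hc.symm ha'
    by_cases hb' : b = (A j).root
    · rw [hb', incl_root, ← incl_root A i] at hd
      rw [incl_injective A i hc, incl_injective A i hd] at hcd
      exact hb hb' hcd
    · exact hij (incl_eq_incl A hd.symm hb').symm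

/-- Green functions with poles in different parts have disjoint supports, so the cross term vanishes
pointwise. -/
theorem degSum_glue_sq_sub (hA : ∀ i, (A i).graph.Connected) (hij : i ≠ j) :
    ((glue A).graph.degSum fun x =>
      ((glue A).green x (incl A i a) - (glue A).green x (incl A j b)) ^ 2) =
      (A i).greenSqSum a + (A j).greenSqSum b := by
  have hs : ∀ i (a : (A i).V),
      ((glue A).graph.degSum fun x => (glue A).green x (incl A i a) ^ 2) =
        (A i).greenSqSum a := by
    intro i a
    unfold greenSqSum
    rw [degSum_glue, Finset.sum_eq_single i]
    · simp only [green_glue_incl hA]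
    · intro j _ hj
      simp only [green_glue_incl_of_ne hA hj]
      simp
    · simp
  rw [← hs, ← hs, ← SimpleGraph.degSum_add, degSum_glue, degSum_glue]
  refine Finset.sum_congr rfl fun k _ => ?_
  congr 1
  ext x
  by_cases hk : k = i
  · subst hk
    rw [green_glue_incl_of_ne hA hij]
    ring
  · rw [green_glue_incl_of_ne hA hk]
    ring

/-- Kemeny's constant of a glued graph with an additional edge between two of its parts. -/
theorem kemeny_glue_sup_edge (hA : ∀ i, (A i).graph.Connected) (hij : i ≠ j)
    {x y : (glue A).V} (hx : x = incl A i a) (hy : y = incl A j b) (hne : x ≠ y)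
    (hadj : ¬ (glue A).graph.Adj x y)
    (hpos : 0 ≤ ∑ k, (A k).vol) :
    kemeny ((glue A).graph ⊔ SimpleGraph.edge x y) = ENNReal.ofReal
      (∑ k, (A k).diagSum + ((A i).green a a + (A j).green b b) -
        (1 + ((A i).green a a + (A j).green b b))⁻¹ * ((A i).greenSqSum a +
          (A j).greenSqSum b + (A i).green a a ^ 2 + (A j).green b b ^ 2) -
        (∑ k, (A k).quadSum + 2 * ((A i).greenSum a + (A j).greenSum b) +
          ((A i).green a a + (A j).green b b) -
          (1 + ((A i).green a a + (A j).green b b))⁻¹ * ((A i).greenSum a -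
            (A j).greenSum b + (A i).green a a - (A j).green b b) ^ 2) /
        (∑ k, (A k).vol + 2)) := by
  have hg := isGreen_green (glue_connected hA)
  have h0 : (glue A).green x y = 0 := by rw [hx, hy, green_glue_incl_of_ne hA hij]
  have hxx : (glue A).green x x = (A i).green a a := by rw [hx, green_glue_incl hA]
  have hyy : (glue A).green y y = (A j).green b b := by rw [hy, green_glue_incl hA]
  have hsx : ((glue A).graph.degSum fun z => (glue A).green z x) = (A i).greenSum a := by
    rw [hx]
    exact greenSum_glue hA i a
  have hsy : ((glue A).graph.degSum fun z => (glue A).green z y) = (A j).greenSum b := by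
    rw [hy]
    exact greenSum_glue hA j b
  have hsq : ((glue A).graph.degSum fun z =>
      ((glue A).green z x - (glue A).green z y) ^ 2) =
      (A i).greenSqSum a + (A j).greenSqSum b := by
    rw [hx, hy, degSum_glue_sq_sub hA hij]
  have hvol : ((glue A).graph ⊔ SimpleGraph.edge x y).degSum (fun _ => 1) =
      ∑ k, (A k).vol + 2 := by
    rw [SimpleGraph.degSum_sup_edge hne hadj, ← vol_glue, vol]
    norm_num
  have h := (hg.sup_edge hne hadj h0).kemeny_eq ((glue_connected hA).mono le_sup_left)
    (by rw [hvol]; linarith)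
  rw [h.2, hvol, hg.diagSum_sup_edge hne hadj h0, hg.quadSum_sup_edge hne hadj h0, hsq, hxx, hyy,
    hsx, hsy, ← diagSum_glue hA, ← quadSum_glue hA]
  rfl

end JoinedEnds

end RootedGraph

/-! ### The criterion for being paradoxical -/

namespace RootedGraph

theorem tilde_parts_connected {G : RootedGraph} (hG : G.graph.Connected) (k₁ k₂ : ℕ) :
    ∀ i, (![G, path k₁, path k₂] i).graph.Connected := by
  intro i
  match i with
  | 0 => exact hG
  | 1 => exact path_connected k₁
  | 2 => exact path_connected k₂

theorem last_eq_root_iff (k : ℕ) : (Fin.last k : (path k).V) = (path k).root ↔ k = 0 := by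
  change Fin.last k = 0 ↔ _
  simp [Fin.ext_iff]

theorem path_adj_root_last (k : ℕ) : (path k).graph.Adj (path k).root (Fin.last k) → k = 1 := by
  intro h
  have h' := SimpleGraph.pathGraph_adj.1 h
  simp only [path, Fin.val_last, Fin.val_zero] at h'
  omega

theorem end₁_ne_end₂ (G : RootedGraph) {k₁ k₂ : ℕ} (h : 2 ≤ k₁ + k₂) :
    G.end₁ k₁ k₂ ≠ G.end₂ k₁ k₂ := by
  refine incl_ne_incl (A := ![G, path k₁, path k₂]) (i := 1) (j := 2) (by decide) fun h1 h2 => ?_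
  have h1' := (last_eq_root_iff k₁).1 h1
  have h2' := (last_eq_root_iff k₂).1 h2
  omega

/-- The ends could be adjacent only for lengths 0 and 1, in either order. -/
theorem not_adj_end₁_end₂ (G : RootedGraph) {k₁ k₂ : ℕ} (h : 2 ≤ k₁ + k₂) :
    ¬ (G.tilde k₁ k₂).graph.Adj (G.end₁ k₁ k₂) (G.end₂ k₁ k₂) := by
  refine not_glue_adj_incl (A := ![G, path k₁, path k₂]) (i := 1) (j := 2) (by decide)
    (fun h1 h2 => ?_) (fun h1 h2 => ?_) (fun h1 h2 => ?_)
  · have h1' := (last_eq_root_iff k₁).1 h1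
    have h2' := (last_eq_root_iff k₂).1 h2
    omega
  · have h1' := (last_eq_root_iff k₁).1 h1
    have h2' := path_adj_root_last k₂ h2
    omega
  · have h1' := (last_eq_root_iff k₂).1 h1
    have h2' := path_adj_root_last k₁ h2.symm
    omega

/-- The decrease of `diagSum` caused by joining the ends of the two attached paths. -/
noncomputable def diagDrop (k₁ k₂ : ℕ) : ℝ :=
  (1 + ((k₁ : ℝ) + k₂))⁻¹ * (k₁ * (2 * (k₁ : ℝ) ^ 2 + 1) / 3 + k₂ * (2 * (k₂ : ℝ) ^ 2 + 1) / 3 +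
    (k₁ : ℝ) ^ 2 + (k₂ : ℝ) ^ 2) - (k₁ + k₂)

/-- The quadratic growth in `k` is what lets one long path force `quadSum` to dominate any multiple
of the squared volume. -/
theorem diagDrop_zero_left (k : ℕ) : diagDrop 0 k = 2 * k * (k - 1) / 3 := by
  unfold diagDrop
  have : (1 + (k : ℝ)) ≠ 0 := by positivity
  push_cast
  rw [zero_add]
  field_simp
  ring

theorem kemeny_tilde {G : RootedGraph} (hG : G.graph.Connected) {k₁ k₂ : ℕ}
    (hpos : 0 < G.vol + 2 * k₁ + 2 * k₂) :
    0 ≤ G.diagSum + (path k₁).diagSum + (path k₂).diagSum -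
        (G.quadSum + (path k₁).quadSum + (path k₂).quadSum) / (G.vol + 2 * k₁ + 2 * k₂) ∧
      kemeny (G.tilde k₁ k₂).graph = ENNReal.ofReal
        (G.diagSum + (path k₁).diagSum + (path k₂).diagSum -
          (G.quadSum + (path k₁).quadSum + (path k₂).quadSum) / (G.vol + 2 * k₁ + 2 * k₂)) := by
  have hA := tilde_parts_connected hG k₁ k₂
  have hv : (glue ![G, path k₁, path k₂]).vol = G.vol + 2 * k₁ + 2 * k₂ := by
    rw [vol_glue, Fin.sum_univ_three, ← vol_path, ← vol_path]
    rfl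
  have h := kemeny_eq (glue_connected hA) (by rwa [hv])
  rw [hv, diagSum_glue hA, quadSum_glue hA, Fin.sum_univ_three, Fin.sum_univ_three] at h
  exact h

/-- The constant `q` serves all `G` because the joined ends lie on the paths and their Green
functions vanish on `G`. -/
theorem kemeny_hatGraph {k₁ k₂ : ℕ} (h : 2 ≤ k₁ + k₂) :
    ∃ q : ℝ, ∀ G : RootedGraph, G.graph.Connected → 0 ≤ G.vol →
      kemeny (G.hatGraph k₁ k₂) = ENNReal.ofReal
        (G.diagSum + (path k₁).diagSum + (path k₂).diagSum - diagDrop k₁ k₂ -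
          (G.quadSum + (path k₁).quadSum + (path k₂).quadSum + q) /
            (G.vol + 2 * k₁ + 2 * k₂ + 2)) := by
  refine ⟨2 * ((path k₁).greenSum (Fin.last k₁) + (path k₂).greenSum (Fin.last k₂)) +
    ((k₁ : ℝ) + k₂) - (1 + ((k₁ : ℝ) + k₂))⁻¹ * ((path k₁).greenSum (Fin.last k₁) -
      (path k₂).greenSum (Fin.last k₂) + k₁ - k₂) ^ 2, fun G hG hvol => ?_⟩
  have hA := tilde_parts_connected hG k₁ k₂
  have hv : ∑ i, (![G, path k₁, path k₂] i).vol = G.vol + 2 * k₁ + 2 * k₂ := by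
    rw [Fin.sum_univ_three, ← vol_path, ← vol_path]
    rfl
  have key := kemeny_glue_sup_edge hA (i := 1) (j := 2) (a := Fin.last k₁) (b := Fin.last k₂)
    (by decide) (x := G.end₁ k₁ k₂) (y := G.end₂ k₁ k₂) rfl rfl (end₁_ne_end₂ G h)
    (not_adj_end₁_end₂ G h) (by rw [hv]; positivity)
  refine key.trans (congrArg ENNReal.ofReal ?_)
  have r : ∀ k, (path k).green (Fin.last k) (Fin.last k) = k := fun k => by
    rw [green_path_last, Fin.val_last]
  rw [hv, Fin.sum_univ_three, Fin.sum_univ_three]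
  change G.diagSum + (path k₁).diagSum + (path k₂).diagSum +
    ((path k₁).green (Fin.last k₁) (Fin.last k₁) + (path k₂).green (Fin.last k₂) (Fin.last k₂)) -
    (1 + ((path k₁).green (Fin.last k₁) (Fin.last k₁) +
      (path k₂).green (Fin.last k₂) (Fin.last k₂)))⁻¹ *
      ((path k₁).greenSqSum (Fin.last k₁) + (path k₂).greenSqSum (Fin.last k₂) +
        (path k₁).green (Fin.last k₁) (Fin.last k₁) ^ 2 +
        (path k₂).green (Fin.last k₂) (Fin.last k₂) ^ 2) -
    (G.quadSum + (path k₁).quadSum + (path k₂).quadSum +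
      2 * ((path k₁).greenSum (Fin.last k₁) + (path k₂).greenSum (Fin.last k₂)) +
      ((path k₁).green (Fin.last k₁) (Fin.last k₁) +
        (path k₂).green (Fin.last k₂) (Fin.last k₂)) -
      (1 + ((path k₁).green (Fin.last k₁) (Fin.last k₁) +
        (path k₂).green (Fin.last k₂) (Fin.last k₂)))⁻¹ *
        ((path k₁).greenSum (Fin.last k₁) - (path k₂).greenSum (Fin.last k₂) +
          (path k₁).green (Fin.last k₁) (Fin.last k₁) -
          (path k₂).green (Fin.last k₂) (Fin.last k₂)) ^ 2) / _ = _
  rw [r, r, greenSqSum_path_last, greenSqSum_path_last, diagDrop]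
  ring

theorem vol_nonneg (G : RootedGraph) : 0 ≤ G.vol :=
  G.graph.degSum_nonneg fun _ => zero_le_one

/-- A connected graph has at least as many edges as a spanning tree. -/
theorem card_le_vol_add_one {G : RootedGraph} (hG : G.graph.Connected) :
    (Fintype.card G.V : ℝ) ≤ G.vol + 1 := by
  have h := hG.card_vert_le_card_edgeSet_add_one
  have h' : (Nat.card G.V : ℝ) ≤ Nat.card G.graph.edgeSet + 1 := by exact_mod_cast h
  have hv : G.vol = 2 * (Nat.card G.graph.edgeSet : ℝ) := SimpleGraph.degSum_one
  rw [Nat.card_eq_fintype_card] at h'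
  have : (0 : ℝ) ≤ Nat.card G.graph.edgeSet := Nat.cast_nonneg _
  linarith

theorem isParadoxical_iff {k₁ k₂ : ℕ} (h : 2 ≤ k₁ + k₂) :
    ∃ β γ : ℝ, ∀ G : RootedGraph, G.graph.Connected →
      (G.IsParadoxical k₁ k₂ ↔
        diagDrop k₁ k₂ * G.vol ^ 2 + β * G.vol + γ < 2 * G.quadSum) := by
  obtain ⟨q, hq⟩ := kemeny_hatGraph h
  set δ := diagDrop k₁ k₂
  set p : ℝ := 2 * k₁ + 2 * k₂ with hp
  -- With m = vol + p, clearing the denominators m and m + 2 leaves δm(m + 2) + qm < 2(Q + P), where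
  -- Q and P are the `quadSum` of `G` and of both paths. These are its coefficients in vol.
  refine ⟨2 * p * δ + 2 * δ + q, δ * p * (p + 2) + q * p -
    2 * ((path k₁).quadSum + (path k₂).quadSum), fun G hG => ?_⟩
  have hp' : (0 : ℝ) < p := by
    have h2 : ((2 : ℕ) : ℝ) ≤ ((k₁ + k₂ : ℕ) : ℝ) := Nat.cast_le.2 h
    push_cast at h2
    linarith
  have hm : 0 < G.vol + 2 * k₁ + 2 * k₂ := by
    have := G.vol_nonneg
    linarith
  obtain ⟨h0, ht⟩ := kemeny_tilde hG hm
  have hm2 : 0 < G.vol + 2 * k₁ + 2 * k₂ + 2 := by linarith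
  unfold IsParadoxical
  rw [ht, hq G hG G.vol_nonneg, ENNReal.ofReal_lt_ofReal_iff_of_nonneg h0]
  simp only [hG, true_and]
  set m := G.vol + 2 * k₁ + 2 * k₂ with hmdef
  have hvol : G.vol = m - p := by rw [hmdef, hp]; ring
  rw [← sub_pos, ← sub_pos (a := 2 * G.quadSum), hvol]
  have e : (G.diagSum + (path k₁).diagSum + (path k₂).diagSum - δ -
      (G.quadSum + (path k₁).quadSum + (path k₂).quadSum + q) / (m + 2) -
      (G.diagSum + (path k₁).diagSum + (path k₂).diagSum -
        (G.quadSum + (path k₁).quadSum + (path k₂).quadSum) / m)) =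
      (2 * G.quadSum - (δ * (m - p) ^ 2 + (2 * p * δ + 2 * δ + q) * (m - p) +
        (δ * p * (p + 2) + q * p - 2 * ((path k₁).quadSum + (path k₂).quadSum)))) /
          (m * (m + 2)) := by
    field_simp
    ring
  rw [e, div_pos_iff_of_pos_right (mul_pos hm hm2)]

/-! ### Growth of `quadSum` against the squared volume -/

open Filter in
/-- A sequence of graphs with unbounded volumes is asymptotically paradoxical only if `quadSum`
grows faster than the square of the volume. -/
theorem AsymptoticallyParadoxical.eventually_le_quadSum {G : ℕ → RootedGraph}
    (hG : AsymptoticallyParadoxical G) (hvol : Tendsto (fun n => (G n).vol) atTop atTop) (K : ℝ) :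
    ∀ᶠ n in atTop, K * (G n).vol ^ 2 ≤ (G n).quadSum := by
  -- This size of `l` ensures 2l(l-1)/3 ≥ 2K + 1. The surplus 1 will absorb the lower-order terms.
  obtain ⟨l, hl⟩ := exists_nat_ge (|K| * 3 + 5)
  have hl2 : (5 : ℝ) ≤ l := by linarith [abs_nonneg K]
  have hl' : 2 ≤ 0 + l := by
    have : (5 : ℕ) ≤ l := by exact_mod_cast hl2
    omega
  obtain ⟨β, γ, h⟩ := isParadoxical_iff hl'
  obtain ⟨N, hN, hpar⟩ := hG.2 0 l hl'
  have hδ : 2 * K + 1 ≤ diagDrop 0 l := by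
    rw [diagDrop_zero_left]
    nlinarith [le_abs_self K]
  -- For such volumes M, βM + γ ≥ -(|β| + |γ|)M ≥ -M².
  filter_upwards [eventually_ge_atTop N, hvol.eventually_ge_atTop (|β| + |γ| + 1)] with n hn hv
  have h1 := (h (G n) (hpar n hn).1).1 (hpar n hn)
  set M := (G n).vol
  have hM : 1 ≤ M := by linarith [abs_nonneg β, abs_nonneg γ]
  have hβ : -|β| * M ≤ β * M := by
    have := neg_abs_le β
    nlinarith
  have hγ : -|γ| * M ≤ γ := by
    have := neg_abs_le γ
    have := abs_nonneg γ
    nlinarith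
  nlinarith [sq_nonneg M]

open Filter in
/-- If `quadSum` grows faster than the square of the volume, then this property, and hence
being eventually paradoxical, is preserved when both change by bounded amounts. -/
theorem eventually_isParadoxical_of_add {G G' : ℕ → RootedGraph} {v q : ℝ} {k₁ k₂ : ℕ}
    (h : 2 ≤ k₁ + k₂) (hvol : Tendsto (fun n => (G n).vol) atTop atTop)
    (hquad : ∀ K : ℝ, ∀ᶠ n in atTop, K * (G n).vol ^ 2 ≤ (G n).quadSum)
    (hconn : ∀ᶠ n in atTop, (G' n).graph.Connected)
    (hv : ∀ᶠ n in atTop, (G' n).vol = (G n).vol + v)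
    (hq : ∀ᶠ n in atTop, (G' n).quadSum = (G n).quadSum + q) :
    ∀ᶠ n in atTop, (G' n).IsParadoxical k₁ k₂ := by
  obtain ⟨β, γ, hiff⟩ := isParadoxical_iff h
  set δ := diagDrop k₁ k₂
  -- The absolute values bound the coefficients of the criterion expanded in M after M is replaced
  -- by M + v and Q by Q + q. The final 1 makes the inequality strict.
  filter_upwards [hconn, hv, hq, hvol.eventually_ge_atTop 1,
    hquad (|δ| + |2 * δ * v + β| + |δ * v ^ 2 + β * v + γ - 2 * q| + 1)] with n h1 h2 h3 h4 h5
  rw [hiff _ h1, h2, h3]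
  set M := (G n).vol
  have hM2 : M ≤ M ^ 2 := by nlinarith
  have e1 : δ * M ^ 2 ≤ |δ| * M ^ 2 := by
    gcongr
    exact le_abs_self δ
  have e2 : (2 * δ * v + β) * M ≤ |2 * δ * v + β| * M ^ 2 :=
    (mul_le_mul_of_nonneg_right (le_abs_self _) (by linarith)).trans
      (mul_le_mul_of_nonneg_left hM2 (abs_nonneg _))
  have e3 : δ * v ^ 2 + β * v + γ - 2 * q ≤ |δ * v ^ 2 + β * v + γ - 2 * q| * M ^ 2 :=
    (le_abs_self _).trans (le_mul_of_one_le_right (abs_nonneg _) (by linarith))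
  have e4 : 0 ≤ |δ| * M ^ 2 := by positivity
  have e5 : 0 ≤ |2 * δ * v + β| * M ^ 2 := by positivity
  have e6 : 0 ≤ |δ * v ^ 2 + β * v + γ - 2 * q| * M ^ 2 := by positivity
  linarith

theorem tendsto_vol {G : ℕ → RootedGraph} (hcard : ∀ n, 1 ≤ n → Fintype.card (G n).V = n)
    (hG : ∀ n, 1 ≤ n → (G n).graph.Connected) :
    Filter.Tendsto (fun n => (G n).vol) Filter.atTop Filter.atTop := by
  refine Filter.tendsto_atTop_mono' _ ?_
    (Filter.tendsto_atTop_add_const_right _ (-1 : ℝ) tendsto_natCast_atTop_atTop)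
  filter_upwards [Filter.eventually_ge_atTop 1] with n hn
  have := card_le_vol_add_one (hG n hn)
  rw [hcard n hn] at this
  linarith

theorem exists_pos_of_eventually {P : ℕ → Prop} (h : ∀ᶠ n in Filter.atTop, P n) :
    ∃ N : ℕ, 0 < N ∧ ∀ n, N ≤ n → P n := by
  obtain ⟨N, hN⟩ := Filter.eventually_atTop.1 h
  exact ⟨N + 1, N.succ_pos, fun n hn => hN n (by omega)⟩

end RootedGraph

theorem proposition4p3 (G : ℕ → RootedGraph)
    (hcard : ∀ n, 1 ≤ n → Fintype.card (G n).V = n)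
    (hG : RootedGraph.AsymptoticallyParadoxical G) :
    (∀ (l : ℕ) (H : Fin l → RootedGraph), (∀ i, (H i).graph.Connected) →
      RootedGraph.AsymptoticallyParadoxical (RootedGraph.gluedSequence H G)) ∧
    (∀ H : RootedGraph, H.graph.Connected → ∀ k₁ k₂ : ℕ, 2 ≤ k₁ + k₂ →
      ∃ N : ℕ, 0 < N ∧ ∀ n, N ≤ n →
        (RootedGraph.glue ![H, G n]).IsParadoxical k₁ k₂) := by
  open RootedGraph Filter in
  have hvol := tendsto_vol hcard hG.1
  have hquad := hG.eventually_le_quadSum hvol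
  refine ⟨fun l H hH => ?_, fun H hH k₁ k₂ hk => exists_pos_of_eventually ?_⟩
  · set s := ∑ i, Fintype.card (H i).V
    have hA : ∀ n, s < n → ∀ i, ((Fin.cons (G (n - s)) H : Fin (l + 1) → RootedGraph)
        i).graph.Connected := by
      intro n hn i
      refine Fin.cases ?_ (fun i => ?_) i
      · exact hG.1 _ (by omega)
      · exact hH i
    have hglue : ∀ n, s < n → gluedSequence H G n =
        glue (Fin.cons (G (n - s)) H : Fin (l + 1) → RootedGraph) := fun n hn =>
      if_neg (not_le.2 hn)
    refine ⟨fun n hn => ?_, fun k₁ k₂ hk => exists_pos_of_eventually ?_⟩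
    · rcases le_or_gt n s with hs | hs
      · rw [show gluedSequence H G n = G n from if_pos hs]
        exact hG.1 n hn
      · rw [hglue n hs]
        exact glue_connected (hA n hs)
    · have hsub : Tendsto (fun n => n - s) atTop atTop := tendsto_sub_atTop_nat s
      have hlarge : ∀ᶠ n in atTop, s < n := eventually_gt_atTop s
      -- Beyond index s, the glued sequence is the shifted sequence `G (n - s)` with volume and
      -- `quadSum` increased by constants.
      refine eventually_isParadoxical_of_add (G := fun n => G (n - s))
        (v := ∑ i, (H i).vol) (q := ∑ i, (H i).quadSum) hk (hvol.comp hsub)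
        (fun K => hsub.eventually (hquad K)) ?_ ?_ ?_ <;> filter_upwards [hlarge] with n hn
      · rw [hglue n hn]
        exact glue_connected (hA n hn)
      · rw [hglue n hn, vol_glue, Fin.sum_univ_succ]
        rfl
      · rw [hglue n hn, quadSum_glue (hA n hn), Fin.sum_univ_succ]
        rfl
  · have hA : ∀ n, 1 ≤ n → ∀ i, (![H, G n] i).graph.Connected := by
      intro n hn i
      match i with
      | 0 => exact hH
      | 1 => exact hG.1 n hn
    refine eventually_isParadoxical_of_add (G := G) (v := H.vol) (q := H.quadSum) hk hvol hquad
      ?_ ?_ ?_ <;> filter_upwards [eventually_ge_atTop 1] with n hn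
    · exact glue_connected (hA n hn)
    · rw [vol_glue, Fin.sum_univ_two, add_comm]
      rfl
    · rw [quadSum_glue (hA n hn), Fin.sum_univ_two, add_comm]
      rfl
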